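/- Let $X$ be a locally compact Polish space and let $m$ be a non-negative (not necessarily finite) Radon measure on $X$, i.e. a Borel measure that is finite on compact sets and inner regular with respect to compact sets. Let $\mathcal M^+(X)$ be the set of all finite non-negative Borel measures on $X$, equipped with the topology $\tau_0$, the weak* topology inherited from $C_0(X)^*$ (the coarsest topology making $\mu\mapsto\int_X f\,d\mu$ continuous for every $f\in C_0(X)$). For $\mathcal E\subset\mathcal M^+(X)$, call a sequence $(\rho_j)$ of lower semicontinuous functions $\rho_j\colon X\to[0,\infty]$ admissible for $\mathcal E$ if $\liminf_{j}\int_X\rho_j\,d\mu\ge 1$ for every $\mu\in\mathcal E$, and define the approximation modulus $$AM(\mathcal E)=\inf\Bigl\{\liminf_{j\to\infty}\int_X\rho_j\,dm\colon (\rho_j)\text{ is admissible for }\mathcal E\Bigr\}\in[0,\infty].$$ A plan is a finite non-negative Borel measure $\eta$ on $\mathcal M^+(X)$; put $\eta^{\#}(B)=\int_{\mathcal M^+(X)}\mu(B)\,d\eta(\mu)$ for Borel $B\subset X$, and let $\eta^*(\mathcal E)=\inf\{\eta(\mathcal B)\colon \mathcal B\supset\mathcal E\text{ Borel}\}$ be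 the outer measure induced by $\eta$. The $1$-plan content is $$\operatorname{Ct}(\mathcal E)=\sup\bigl\{\eta^*(\mathcal E)\colon \eta\text{ is a plan},\ \eta^{\#}\ll m,\ \|\eta^{\#}\|_{L^\infty(m)}\le 1\bigr\}\in[0,\infty],$$ where $\|\eta^{\#}\|_{L^\infty(m)}$ is the $L^\infty(m)$ norm of the density of $\eta^{\#}$ with respect to $m$. Then for every family $\mathcal E\subset\mathcal M^+(X)$, $$\operatorname{Ct}(\mathcal E)\le AM(\mathcal E)=\inf\bigl\{\operatorname{Ct}(\mathcal G)\colon \mathcal E\subset\mathcal G\subset\mathcal M^+(X),\ \mathcal G\text{ is } F_\sigma\text{ in }\tau_0\bigr\}.$$ -/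

import Mathlib

open MeasureTheory Filter Topology
open scoped ENNReal ZeroAtInfty

noncomputable section

/-- `MPlus X` is the cone `M⁺(X)` of all finite positive (Borel) measures on `X`. -/
def MPlus (X : Type*) [MeasurableSpace X] : Type _ := {μ : Measure X // IsFiniteMeasure μ}

namespace MPlus

variable {X : Type*} [MeasurableSpace X]

/-- The underlying measure of a point of `M⁺(X)`. -/
def toMeasure (μ : MPlus X) : Measure X := μ.1

instance instFinite (μ : MPlus X) : IsFiniteMeasure μ.toMeasure := μ.2

/-- The topology `τ₀` on `M⁺(X)`: the coarsest topology for which every map `μ ↦ ∫ f dμ`,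
`f ∈ C₀(X)`, is continuous, i.e. the weak* topology inherited from `C₀(X)*`. -/
instance instTopologicalSpace [TopologicalSpace X] : TopologicalSpace (MPlus X) :=
  TopologicalSpace.induced (fun (μ : MPlus X) (f : C₀(X, ℝ)) => ∫ x, f x ∂μ.toMeasure)
    Pi.topologicalSpace

/-- The Borel `σ`-algebra of `(M⁺(X), τ₀)`. -/
instance instMeasurableSpace [TopologicalSpace X] : MeasurableSpace (MPlus X) :=
  borel (MPlus X)

instance instBorelSpace [TopologicalSpace X] : BorelSpace (MPlus X) := ⟨rfl⟩

end MPlus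

/-- `G ⊆ Y` is an `F_σ` set: a countable union of closed sets. -/
def IsFSigma {Y : Type*} [TopologicalSpace Y] (G : Set Y) : Prop :=
  ∃ F : ℕ → Set Y, (∀ n, IsClosed (F n)) ∧ G = ⋃ n, F n

/-- A sequence of lower semicontinuous functions `ρ j : X → [0, ∞]` is admissible for `E ⊆ M⁺(X)`
if `liminf_j ∫ ρ j dμ ≥ 1` for every `μ ∈ E`. -/
structure IsAdmissibleSeq {X : Type*} [TopologicalSpace X] [MeasurableSpace X]
    (ρ : ℕ → X → ℝ≥0∞) (E : Set (MPlus X)) : Prop where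
  lsc : ∀ j, LowerSemicontinuous (ρ j)
  one_le : ∀ μ ∈ E, 1 ≤ liminf (fun j => ∫⁻ x, ρ j x ∂μ.toMeasure) atTop

/-- The approximation modulus `AM(E)` with respect to the reference measure `m` (exponent `1`). -/
def AM {X : Type*} [TopologicalSpace X] [MeasurableSpace X] (m : Measure X)
    (E : Set (MPlus X)) : ℝ≥0∞ :=
  ⨅ (ρ : ℕ → X → ℝ≥0∞) (_ : IsAdmissibleSeq ρ E), liminf (fun j => ∫⁻ x, ρ j x ∂m) atTop

/-- The measure `η^#` on `X` attached to a measure `η` on `M⁺(X)`,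
`η^#(B) = ∫ μ(B) dη(μ)` for every Borel set `B` (see `barycenter_apply`). -/
def barycenter {X : Type*} [TopologicalSpace X] [MeasurableSpace X]
    (η : Measure (MPlus X)) : Measure X :=
  η.bind MPlus.toMeasure

/-- `η` competes in the definition of the `1`-plan content: it is a plan (a finite Borel measure on
`M⁺(X)`), `η^# ≪ m`, and the density of `η^#` with respect to `m` satisfies
`‖η^#‖_{L^∞(m)} ≤ 1`. -/
structure IsContentPlan {X : Type*} [TopologicalSpace X] [MeasurableSpace X] (m : Measure X)
    (η : Measure (MPlus X)) : Prop where
  finite : IsFiniteMeasure η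
  absolutelyContinuous : barycenter η ≪ m
  density : ∃ f : X → ℝ≥0∞, Measurable f ∧ barycenter η = m.withDensity f ∧ eLpNorm f ∞ m ≤ 1

/-- The `1`-plan content `Ct(E)`. As `E` is arbitrary, `η E` is the outer measure
`inf {η(B) : B ⊇ E Borel}`. -/
def Ct {X : Type*} [TopologicalSpace X] [MeasurableSpace X] (m : Measure X)
    (E : Set (MPlus X)) : ℝ≥0∞ :=
  ⨆ (η : Measure (MPlus X)) (_ : IsContentPlan m η), η E

section Measurability

theorem MPlus.continuous_integral {X : Type*} [TopologicalSpace X] [MeasurableSpace X]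
    (f : C₀(X, ℝ)) :
    Continuous (fun μ : MPlus X => ∫ x, f x ∂μ.toMeasure) :=
  (continuous_apply f).comp
    (continuous_induced_dom (f := fun (μ : MPlus X) (f : C₀(X, ℝ)) => ∫ x, f x ∂μ.toMeasure))

variable {X : Type*} [TopologicalSpace X] [PolishSpace X] [LocallyCompactSpace X]
  [MeasurableSpace X] [BorelSpace X]

theorem MPlus.measurable_apply_of_isOpen {U : Set X} (hU : IsOpen U) :
    Measurable (fun μ : MPlus X => μ.toMeasure U) := by
  let _ := TopologicalSpace.upgradeIsCompletelyMetrizable X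
  obtain ⟨F, hFc, hFU, hFun, hFm⟩ := hU.exists_iUnion_isClosed
  have hK : ∀ n, IsCompact (F n ∩ compactCovering X n) := fun n =>
    (isCompact_compactCovering X n).inter_left (hFc n)
  have hf : ∀ n, ∃ f : C(X, ℝ), Set.EqOn f 1 (F n ∩ compactCovering X n) ∧ Set.EqOn f 0 Uᶜ ∧
      HasCompactSupport f ∧ ∀ x, f x ∈ Set.Icc (0 : ℝ) 1 := fun n =>
    exists_continuous_one_zero_of_isCompact (hK n) hU.isClosed_compl
      (Set.disjoint_compl_right_iff_subset.2 (Set.inter_subset_left.trans (hFU n)))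
  choose f hf1 hf0 hfc hf01 using hf
  have hlim : ∀ x, Tendsto (fun n => ENNReal.ofReal (f n x)) atTop
      (𝓝 (U.indicator (fun _ => (1 : ℝ≥0∞)) x)) := by
    intro x
    by_cases hx : x ∈ U
    · have h1 : x ∈ ⋃ n, F n := hFun ▸ hx
      have h2 : x ∈ ⋃ n, compactCovering X n := by simp [iUnion_compactCovering]
      obtain ⟨a, ha⟩ := Set.mem_iUnion.1 h1
      obtain ⟨b, hb⟩ := Set.mem_iUnion.1 h2
      refine tendsto_const_nhds.congr' ?_
      filter_upwards [eventually_ge_atTop (max a b)] with n hn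
      have := hf1 n ⟨hFm (le_of_max_le_left hn) ha,
        compactCovering_subset X (le_of_max_le_right hn) hb⟩
      simp [this, hx]
    · have : ∀ n, f n x = 0 := fun n => hf0 n hx
      simp [this, hx]
  have hmeas : ∀ n, Measurable (fun μ : MPlus X => ∫⁻ x, ENNReal.ofReal (f n x) ∂μ.toMeasure) := by
    intro n
    have hz : Tendsto (f n) (cocompact X) (𝓝 0) := (hfc n).is_zero_at_infty
    let g : C₀(X, ℝ) := ⟨f n, hz⟩
    have h1 := ((MPlus.continuous_integral g).measurable).ennreal_ofReal
    convert h1 using 2 with μ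
    refine (ofReal_integral_eq_lintegral_ofReal ?_ (Eventually.of_forall fun x => (hf01 n x).1)).symm
    exact (f n).continuous.integrable_of_hasCompactSupport (hfc n)
  refine measurable_of_tendsto_metrizable hmeas (tendsto_pi_nhds.2 fun μ => ?_)
  have := tendsto_lintegral_of_dominated_convergence (μ := μ.toMeasure)
    (F := fun n x => ENNReal.ofReal (f n x)) (f := U.indicator (fun _ => (1 : ℝ≥0∞)))
    (fun _ => (1 : ℝ≥0∞)) (fun n => (f n).continuous.measurable.ennreal_ofReal)
    (fun n => Eventually.of_forall fun x => by simpa using (hf01 n x).2)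
    (by simp) (Eventually.of_forall hlim)
  simpa [lintegral_indicator_const hU.measurableSet] using this

theorem MPlus.measurable_toMeasure :
    Measurable (MPlus.toMeasure : MPlus X → Measure X) :=
  Measurable.measure_of_isPiSystem BorelSpace.measurable_eq
    isPiSystem_isOpen (fun _ hs => MPlus.measurable_apply_of_isOpen hs)
    (MPlus.measurable_apply_of_isOpen isOpen_univ)

theorem barycenter_apply (η : Measure (MPlus X)) {B : Set X} (hB : MeasurableSet B) :
    barycenter η B = ∫⁻ μ, μ.toMeasure B ∂η :=
  Measure.bind_apply hB MPlus.measurable_toMeasure.aemeasurable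

end Measurability

end

/-!
Weak duality `Ct m E ≤ AM m E` (`Ct_le_AM`) follows by integrating the admissibility condition
against a plan `η` and applying Fatou's lemma, since `η^# ≤ m`. In particular it holds for every
`F_σ` family `G`, so that the formula for `AM m E` follows from two facts: `AM m G ≤ Ct m G` for
`F_σ` families `G`, and an outer approximation of `E` by `F_σ` families.

*Outer approximation* (`iInf_Ct_isFSigma_le_AM`). Let `ρ` be admissible for `E` with all
`∫ ρ j dm ≤ a`. Density of `C_c(X)` in `L¹(m)` and the Vitali-Carathéodory theorem give
`ρ j ≤ φ j + g j` with `φ j` continuous of compact support and `g j` lower semicontinuous with very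
small integral. With `γ = ∑ g j`, the set of `μ` such that `∫ φ j dμ ≥ 1 - 2δ` for all large `j`, or
`∫ γ dμ > δ`, is an `F_σ` set containing `E`, and `φ j / (1 - 2δ) + γ / δ` is admissible for it.

*Strong duality* (`IsFSigma.AM_le_Ct`). Balls of `M⁺(X)` are weak* compact
(`MPlus.isCompact_setOf_real_univ_le`), hence an `F_σ` family is an increasing union of compact
families `K n`, and a sequence of functions, the `n`-th one with integral at least `1` against all
of `K n`, is admissible for it. For compact `K` the infimum of `∫ φ dm` over continuous `φ ≥ 0` of
compact support with `∫ φ dμ ≥ 1` on `K` is at most `Ct m K`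
(`exists_compactlySupported_of_Ct_lt`): the Hahn-Banach theorem produces a positive functional `L`
on `C(K)` which is bounded by `∫ φ dm` at `μ ↦ ∫ φ dμ` and whose value at `1` is this infimum, up to
a penalty for slack in the constraint. By the Riesz-Markov-Kakutani theorem `L` is integration
against a measure on `K`, which is a plan with barycenter at most `m`.
-/

open scoped CompactlySupported

/-! ### Compactly supported minorants of lower semicontinuous functions -/

section CompactlySupported

variable {X : Type*} [TopologicalSpace X]

theorem CompactlySupportedContinuousMap.lintegral_ofReal [MeasurableSpace X]
    [OpensMeasurableSpace X] (μ : Measure X) [IsFiniteMeasureOnCompacts μ]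
    {φ : C_c(X, ℝ)} (hφ : 0 ≤ φ) :
    ∫⁻ x, ENNReal.ofReal (φ x) ∂μ = ENNReal.ofReal (∫ x, φ x ∂μ) :=
  (ofReal_integral_eq_lintegral_ofReal
    (φ.continuous.integrable_of_hasCompactSupport φ.hasCompactSupport)
    (Eventually.of_forall fun x => hφ x)).symm

theorem exists_compactlySupported_le_lowerSemicontinuous [T2Space X] [LocallyCompactSpace X]
    {g : X → ℝ≥0∞} (hg : LowerSemicontinuous g) {x : X} {c : ℝ≥0∞} (hc : c < g x) :
    ∃ φ : C_c(X, ℝ), 0 ≤ φ ∧ (∀ y, ENNReal.ofReal (φ y) ≤ g y) ∧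
      c ≤ ENNReal.ofReal (φ x) := by
  obtain ⟨r, hcr, hr⟩ := ENNReal.lt_iff_exists_nnreal_btwn.1 hc
  have hU : IsOpen {y | (r : ℝ≥0∞) < g y} := hg.isOpen_preimage _
  obtain ⟨f, hf1, hf0, hfc, hf01⟩ := exists_continuous_one_zero_of_isCompact
    (isCompact_singleton (x := x)) hU.isClosed_compl
    (Set.disjoint_compl_right_iff_subset.2 (Set.singleton_subset_iff.2 hr))
  let ψ : C_c(X, ℝ) := ⟨f, hfc⟩
  have hψ : ∀ y, ψ y = f y := fun _ => rfl
  refine ⟨(r : ℝ) • ψ, fun y => ?_, fun y => ?_, ?_⟩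
  · exact mul_nonneg r.2 (hf01 y).1
  · by_cases hy : (r : ℝ≥0∞) < g y
    · refine le_trans ?_ hy.le
      rw [← ENNReal.ofReal_coe_nnreal]
      exact ENNReal.ofReal_le_ofReal (mul_le_of_le_one_right r.2 (hf01 y).2)
    · have : f y = 0 := hf0 hy
      simp [hψ, this]
  · have : f x = 1 := hf1 rfl
    simpa [hψ, this] using hcr.le

/-- On a locally compact second countable space, a lower semicontinuous function with values in
`[0, ∞]` is the limit of an increasing sequence of nonnegative compactly supported continuous
functions. -/
theorem LowerSemicontinuous.exists_monotone_compactlySupported [T2Space X]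
    [LocallyCompactSpace X] [SecondCountableTopology X]
    {g : X → ℝ≥0∞} (hg : LowerSemicontinuous g) :
    ∃ φ : ℕ → C_c(X, ℝ), (∀ n, 0 ≤ φ n) ∧ Monotone φ ∧
      ∀ x, ⨆ n, ENNReal.ofReal (φ n x) = g x := by
  let S : Set (X → ℝ≥0∞) :=
    {h | ∃ φ : C_c(X, ℝ), 0 ≤ φ ∧ (∀ y, ENNReal.ofReal (φ y) ≤ g y) ∧
      h = fun y => ENNReal.ofReal (φ y)}
  have hS : IsLUB S g := by
    refine isLUB_pi.2 fun x => ⟨?_, fun b hb => le_of_forall_lt fun c hc => ?_⟩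
    · rintro _ ⟨_, ⟨φ, -, hφ, rfl⟩, rfl⟩
      exact hφ x
    · obtain ⟨c', hcc', hc'⟩ := exists_between hc
      obtain ⟨φ, h0, hφ, hφx⟩ := exists_compactlySupported_le_lowerSemicontinuous hg hc'
      exact hcc'.trans_le (hφx.trans (hb ⟨_, ⟨φ, h0, hφ, rfl⟩, rfl⟩))
  have hScont : ∀ f ∈ S, LowerSemicontinuous f := by
    rintro _ ⟨φ, -, -, rfl⟩
    exact (ENNReal.continuous_ofReal.comp φ.continuous).lowerSemicontinuous
  obtain ⟨T, hTS, hTc, hT⟩ := exists_countable_lowerSemicontinuous_isLUB hScont hS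
  have hT'S : insert (fun _ => (0 : ℝ≥0∞)) T ⊆ S := Set.insert_subset ⟨0, le_rfl, by simp, by simp⟩ hTS
  obtain ⟨f, hf⟩ := (hTc.insert (fun _ => (0 : ℝ≥0∞))).exists_eq_range (Set.insert_nonempty _ _)
  have hfS : ∀ n, f n ∈ S := fun n => hT'S (by rw [hf]; exact Set.mem_range_self n)
  choose φ h0 hφ hfφ using hfS
  have hle : ∀ n x, ENNReal.ofReal (partialSups φ n x) ≤ g x := by
    intro n x
    induction n with
    | zero => simpa using hφ 0 x
    | succ n ih =>
      rw [partialSups_add_one, CompactlySupportedContinuousMap.sup_apply, ENNReal.ofReal_max]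
      exact max_le ih (hφ _ x)
  refine ⟨partialSups φ, fun n => (h0 n).trans (le_partialSups φ n), (partialSups φ).monotone,
    fun x => le_antisymm (iSup_le fun n => hle n x) ?_⟩
  refine (isLUB_pi.1 hT x).2 ?_
  rintro _ ⟨h, hh, rfl⟩
  obtain ⟨n, rfl⟩ : h ∈ Set.range f := hf ▸ Set.mem_insert_of_mem _ hh
  refine le_iSup_of_le n ?_
  rw [hfφ n]
  exact ENNReal.ofReal_le_ofReal (le_partialSups φ n x)

theorem lintegral_eq_iSup_compactlySupported [MeasurableSpace X] [OpensMeasurableSpace X]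
    (μ : Measure X) {g : X → ℝ≥0∞} {φ : ℕ → C_c(X, ℝ)} (hφ : Monotone φ)
    (hg : ∀ x, ⨆ n, ENNReal.ofReal (φ n x) = g x) :
    ∫⁻ x, g x ∂μ = ⨆ n, ∫⁻ x, ENNReal.ofReal (φ n x) ∂μ := by
  simp_rw [← hg]
  exact lintegral_iSup (fun n => (φ n).continuous.measurable.ennreal_ofReal)
    fun i j hij x => ENNReal.ofReal_le_ofReal (hφ hij x)

/-- If a measure is dominated by an outer regular one on nonnegative compactly supported
continuous functions, then it is dominated on all sets. -/
theorem measure_le_of_lintegral_compactlySupported_le [T2Space X] [LocallyCompactSpace X]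
    [SecondCountableTopology X] [MeasurableSpace X] [BorelSpace X]
    {ν μ : Measure X} [μ.OuterRegular]
    (h : ∀ φ : C_c(X, ℝ), 0 ≤ φ →
      ∫⁻ x, ENNReal.ofReal (φ x) ∂ν ≤ ∫⁻ x, ENNReal.ofReal (φ x) ∂μ) :
    ν ≤ μ := by
  refine Measure.le_intro fun s _ _ => ?_
  rw [s.measure_eq_iInf_isOpen μ]
  refine le_iInf₂ fun U hsU => le_iInf fun hU => (measure_mono hsU).trans ?_
  obtain ⟨φ, h0, hmono, hφ⟩ :=
    (hU.lowerSemicontinuous_indicator (zero_le (a := (1 : ℝ≥0∞)))).exists_monotone_compactlySupported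
  rw [← one_mul (ν U), ← one_mul (μ U), ← lintegral_indicator_const hU.measurableSet,
    ← lintegral_indicator_const hU.measurableSet, lintegral_eq_iSup_compactlySupported ν hmono hφ,
    lintegral_eq_iSup_compactlySupported μ hmono hφ]
  exact iSup_mono fun n => h _ (h0 n)

end CompactlySupported

/-! ### Operations on `F_σ` sets -/

section FSigma

variable {Y : Type*} [TopologicalSpace Y]

theorem IsClosed.isFSigma {F : Set Y} (hF : IsClosed F) : IsFSigma F :=
  ⟨fun _ => F, fun _ => hF, (Set.iUnion_const F).symm⟩

theorem IsFSigma.iUnion {ι : Type*} [Countable ι] [Nonempty ι] {G : ι → Set Y}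
    (hG : ∀ i, IsFSigma (G i)) : IsFSigma (⋃ i, G i) := by
  choose F hF hGF using hG
  obtain ⟨e, he⟩ := exists_surjective_nat (ι × ℕ)
  refine ⟨fun n => F (e n).1 (e n).2, fun n => hF _ _, ?_⟩
  rw [he.iUnion_comp (fun p : ι × ℕ => F p.1 p.2), Set.iUnion_prod']
  exact Set.iUnion_congr hGF

theorem IsFSigma.union {G H : Set Y} (hG : IsFSigma G) (hH : IsFSigma H) :
    IsFSigma (G ∪ H) := by
  rw [Set.union_eq_iUnion]
  exact IsFSigma.iUnion fun b => by cases b <;> assumption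

end FSigma

/-! ### Weak duality -/

section ModulusContent

variable {X : Type*} [TopologicalSpace X] [MeasurableSpace X]

theorem IsContentPlan.barycenter_le {m : Measure X} {η : Measure (MPlus X)}
    (h : IsContentPlan m η) : barycenter η ≤ m := by
  obtain ⟨f, -, hf, hf1⟩ := h.density
  rw [hf]
  conv_rhs => rw [← withDensity_one (μ := m)]
  refine withDensity_mono ?_
  filter_upwards [enorm_ae_le_eLpNormEssSup f m] with x hx
  rw [eLpNorm_exponent_top] at hf1
  exact hx.trans hf1

/-- A finite plan whose barycenter is dominated by `m` competes for the content: the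
Radon-Nikodym derivative is a density bounded by `1`. -/
theorem IsContentPlan.of_barycenter_le {m : Measure X} [SigmaFinite m]
    {η : Measure (MPlus X)} [IsFiniteMeasure η] [SigmaFinite (barycenter η)]
    (h : barycenter η ≤ m) :
    IsContentPlan m η where
  finite := inferInstance
  absolutelyContinuous := Measure.absolutelyContinuous_of_le h
  density := by
    refine ⟨(barycenter η).rnDeriv m, Measure.measurable_rnDeriv _ _,
      (Measure.withDensity_rnDeriv_eq _ _ (Measure.absolutelyContinuous_of_le h)).symm, ?_⟩
    rw [eLpNorm_exponent_top]
    refine eLpNormEssSup_le_of_ae_enorm_bound ?_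
    filter_upwards [Measure.rnDeriv_le_one_of_le h] with x hx
    simpa using hx

theorem AM_mono (m : Measure X) {E G : Set (MPlus X)} (h : E ⊆ G) : AM m E ≤ AM m G :=
  le_iInf₂ fun ρ hρ => iInf₂_le ρ ⟨hρ.lsc, fun μ hμ => hρ.one_le μ (h hμ)⟩

theorem Ct_mono (m : Measure X) {E G : Set (MPlus X)} (h : E ⊆ G) : Ct m E ≤ Ct m G :=
  iSup₂_mono fun _ _ => measure_mono h

theorem MPlus.continuous_lintegral_compactlySupported [OpensMeasurableSpace X]
    {φ : C_c(X, ℝ)} (hφ : 0 ≤ φ) :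
    Continuous fun μ : MPlus X => ∫⁻ x, ENNReal.ofReal (φ x) ∂μ.toMeasure := by
  simp_rw [fun μ : MPlus X => φ.lintegral_ofReal μ.toMeasure hφ]
  exact ENNReal.continuous_ofReal.comp (MPlus.continuous_integral (φ : C₀(X, ℝ)))

end ModulusContent

section Duality

variable {X : Type*} [TopologicalSpace X] [PolishSpace X] [LocallyCompactSpace X]
  [MeasurableSpace X] [BorelSpace X]

theorem lintegral_barycenter (η : Measure (MPlus X)) {f : X → ℝ≥0∞} (hf : Measurable f) :
    ∫⁻ x, f x ∂(barycenter η) = ∫⁻ μ, ∫⁻ x, f x ∂μ.toMeasure ∂η :=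
  Measure.lintegral_bind MPlus.measurable_toMeasure.aemeasurable hf.aemeasurable

theorem MPlus.measurable_lintegral {f : X → ℝ≥0∞} (hf : Measurable f) :
    Measurable (fun μ : MPlus X => ∫⁻ x, f x ∂μ.toMeasure) :=
  (Measure.measurable_lintegral hf).comp MPlus.measurable_toMeasure

/-- Weak duality: integrate the admissibility condition against a plan and apply Fatou's lemma. -/
theorem Ct_le_AM (m : Measure X) (E : Set (MPlus X)) : Ct m E ≤ AM m E := by
  refine iSup₂_le fun η hη => le_iInf₂ fun ρ hρ => ?_
  have hmeas : ∀ j, Measurable (ρ j) := fun j => (hρ.lsc j).measurable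
  have hmeas' : ∀ j, Measurable fun μ : MPlus X => ∫⁻ x, ρ j x ∂μ.toMeasure :=
    fun j => MPlus.measurable_lintegral (hmeas j)
  calc η E ≤ η {μ | 1 ≤ liminf (fun j => ∫⁻ x, ρ j x ∂μ.toMeasure) atTop} :=
        measure_mono hρ.one_le
    _ = 1 * η {μ | 1 ≤ liminf (fun j => ∫⁻ x, ρ j x ∂μ.toMeasure) atTop} := (one_mul _).symm
    _ ≤ ∫⁻ μ, liminf (fun j => ∫⁻ x, ρ j x ∂μ.toMeasure) atTop ∂η :=
        mul_meas_ge_le_lintegral (Measurable.liminf hmeas') 1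
    _ ≤ liminf (fun j => ∫⁻ μ, ∫⁻ x, ρ j x ∂μ.toMeasure ∂η) atTop := lintegral_liminf_le hmeas'
    _ = liminf (fun j => ∫⁻ x, ρ j x ∂(barycenter η)) atTop := by
        simp_rw [lintegral_barycenter η (hmeas _)]
    _ ≤ liminf (fun j => ∫⁻ x, ρ j x ∂m) atTop :=
        liminf_le_liminf (Eventually.of_forall fun j => lintegral_mono' hη.barycenter_le le_rfl)

theorem MPlus.isFSigma_lt_lintegral {g : X → ℝ≥0∞} (hg : LowerSemicontinuous g) (c : ℝ≥0∞) :
    IsFSigma {μ : MPlus X | c < ∫⁻ x, g x ∂μ.toMeasure} := by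
  obtain ⟨φ, h0, hmono, hφ⟩ := hg.exists_monotone_compactlySupported
  have h : {μ : MPlus X | c < ∫⁻ x, g x ∂μ.toMeasure} =
      ⋃ n, {μ : MPlus X | c < ∫⁻ x, ENNReal.ofReal (φ n x) ∂μ.toMeasure} := by
    ext μ
    simp [lintegral_eq_iSup_compactlySupported μ.toMeasure hmono hφ, lt_iSup_iff]
  rw [h]
  refine IsFSigma.iUnion fun n => ?_
  let _ := TopologicalSpace.pseudoMetrizableSpacePseudoMetric ℝ≥0∞
  obtain ⟨F, hFc, -, hF, -⟩ := (isOpen_Ioi (a := c)).exists_iUnion_isClosed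
  refine ⟨_, fun k => (hFc k).preimage (MPlus.continuous_lintegral_compactlySupported (h0 n)), ?_⟩
  rw [← Set.preimage_iUnion, hF]
  rfl

/-- A function with finite integral is dominated by the sum of a compactly supported continuous
function with nearly the same integral and a lower semicontinuous one with small integral: apply
the Vitali-Carathéodory theorem to the error of an `L¹` approximation. -/
theorem exists_le_compactlySupported_add_lowerSemicontinuous (m : Measure X) [m.Regular]
    {ρ : X → ℝ≥0∞} (hρ : Measurable ρ) (hfin : ∫⁻ x, ρ x ∂m ≠ ∞) {ε : ℝ≥0∞} (hε : ε ≠ 0) :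
    ∃ (φ : C_c(X, ℝ)) (g : X → ℝ≥0∞), 0 ≤ φ ∧ LowerSemicontinuous g ∧
      (∀ x, ρ x ≤ ENNReal.ofReal (φ x) + g x) ∧
      ∫⁻ x, ENNReal.ofReal (φ x) ∂m ≤ ∫⁻ x, ρ x ∂m + ε ∧ ∫⁻ x, g x ∂m ≤ ε := by
  let _ := TopologicalSpace.upgradeIsCompletelyMetrizable X
  have hε2 : ε / 2 ≠ 0 := by simpa using hε
  obtain ⟨f, hfc, hf, hfcont, -⟩ :=
    (integrable_toReal_of_lintegral_ne_top hρ.aemeasurable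
      hfin).exists_hasCompactSupport_lintegral_sub_le hε2
  let φ : C_c(X, ℝ) := ⟨⟨f, hfcont⟩, hfc⟩ ⊔ 0
  have hφ : ∀ x, ENNReal.ofReal (φ x) = ENNReal.ofReal (f x) := fun x => by
    change ENNReal.ofReal (max (f x) 0) = _
    rw [ENNReal.ofReal_max]; simp
  have hφm : Measurable fun x => ENNReal.ofReal (f x) := hfcont.measurable.ennreal_ofReal
  have hlt : ∀ᵐ x ∂m, ρ x < ∞ := ae_lt_top hρ hfin
  obtain ⟨g, hug, hg, hgint⟩ := exists_le_lowerSemicontinuous_lintegral_ge m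
    (fun x => ρ x - ENNReal.ofReal (f x)) (hρ.sub hφm) hε2
  refine ⟨φ, g, le_sup_right, hg, fun x => ?_, ?_, ?_⟩
  · rw [hφ]
    exact le_add_tsub.trans (add_le_add_right (hug x) _)
  · simp_rw [hφ]
    calc ∫⁻ x, ENNReal.ofReal (f x) ∂m ≤ ∫⁻ x, ρ x + ‖(ρ x).toReal - f x‖ₑ ∂m := by
          refine lintegral_mono_ae ?_
          filter_upwards [hlt] with x hx
          rw [← ENNReal.ofReal_toReal hx.ne, Real.enorm_eq_ofReal_abs,
            ← ENNReal.ofReal_add ENNReal.toReal_nonneg (abs_nonneg _),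
            ENNReal.toReal_ofReal ENNReal.toReal_nonneg]
          refine ENNReal.ofReal_le_ofReal ?_
          linarith [neg_abs_le ((ρ x).toReal - f x)]
      _ = ∫⁻ x, ρ x ∂m + ∫⁻ x, ‖(ρ x).toReal - f x‖ₑ ∂m := lintegral_add_left hρ _
      _ ≤ ∫⁻ x, ρ x ∂m + ε := by
          gcongr
          exact hf.trans ENNReal.half_le_self
  · calc ∫⁻ x, g x ∂m ≤ ∫⁻ x, ρ x - ENNReal.ofReal (f x) ∂m + ε / 2 := hgint
      _ ≤ ∫⁻ x, ‖(ρ x).toReal - f x‖ₑ ∂m + ε / 2 := by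
          gcongr ?_ + _
          refine lintegral_mono_ae ?_
          filter_upwards [hlt] with x hx
          rw [tsub_le_iff_right, Real.enorm_eq_ofReal_abs]
          nth_rewrite 1 [← ENNReal.ofReal_toReal hx.ne]
          refine (ENNReal.ofReal_le_ofReal ?_).trans ENNReal.ofReal_add_le
          linarith [le_abs_self ((ρ x).toReal - f x)]
      _ ≤ ε / 2 + ε / 2 := by gcongr
      _ = ε := ENNReal.add_halves ε

end Duality

/-! ### Outer approximation by `F_σ` families -/

section OuterRegularity

variable {X : Type*} [TopologicalSpace X] [PolishSpace X] [LocallyCompactSpace X]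
  [MeasurableSpace X] [BorelSpace X]

/-- An admissible sequence with `∫ ρ j dm ≤ a` can be enlarged, at an arbitrarily small cost, to one
which is admissible for an `F_σ` family. -/
theorem exists_isFSigma_AM_le (m : Measure X) [m.Regular] {E : Set (MPlus X)}
    {ρ : ℕ → X → ℝ≥0∞} (hρ : IsAdmissibleSeq ρ E) {a : ℝ≥0∞} (ha : a ≠ ∞)
    (hρa : ∀ j, ∫⁻ x, ρ j x ∂m ≤ a) {δ : ℝ≥0∞} (hδ : δ ≠ 0) (hδ' : δ + δ < 1) :
    ∃ G : Set (MPlus X), E ⊆ G ∧ IsFSigma G ∧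
      AM m G ≤ (1 - (δ + δ))⁻¹ * (a + δ * δ) + δ := by
  have hδt : δ ≠ ∞ := ((le_self_add).trans_lt hδ').ne_top
  set c : ℝ≥0∞ := 1 - (δ + δ) with hc
  have hc0 : c ≠ 0 := (tsub_pos_of_lt hδ').ne'
  have hct : c ≠ ∞ := ENNReal.sub_ne_top ENNReal.one_ne_top
  -- The errors sum up to at most `δ²`, so that the error term costs at most `δ⁻¹ * δ² = δ`
  -- when it is scaled to have integral above `1` wherever its integral exceeds `δ`.
  obtain ⟨ε, hε, hεsum⟩ := ENNReal.exists_pos_sum_of_countable' (mul_ne_zero hδ hδ) ℕ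
  choose φ g h0 hg hle hφint hgint using fun j =>
    exists_le_compactlySupported_add_lowerSemicontinuous m (hρ.lsc j).measurable
      ((hρa j).trans_lt ha.lt_top).ne (hε j).ne'
  let γ : X → ℝ≥0∞ := fun x => ∑' j, g j x
  have hγ : LowerSemicontinuous γ := lowerSemicontinuous_tsum hg
  have hγint : ∫⁻ x, γ x ∂m ≤ δ * δ := by
    rw [lintegral_tsum fun j => (hg j).measurable.aemeasurable]
    exact (ENNReal.tsum_le_tsum hgint).trans hεsum.le
  have hφm : ∀ j, Measurable fun x => ENNReal.ofReal (φ j x) :=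
    fun j => (φ j).continuous.measurable.ennreal_ofReal
  refine ⟨(⋃ N, ⋂ j ≥ N, {μ : MPlus X | c ≤ ∫⁻ x, ENNReal.ofReal (φ j x) ∂μ.toMeasure}) ∪
      {μ : MPlus X | δ < ∫⁻ x, γ x ∂μ.toMeasure}, fun μ hμ => ?_, ?_, ?_⟩
  · by_cases hμγ : δ < ∫⁻ x, γ x ∂μ.toMeasure
    · exact Or.inr hμγ
    · left
      have hlt : 1 - δ < liminf (fun j => ∫⁻ x, ρ j x ∂μ.toMeasure) atTop :=
        (ENNReal.sub_lt_self ENNReal.one_ne_top one_ne_zero hδ).trans_le (hρ.one_le μ hμ)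
      obtain ⟨N, hN⟩ := eventually_atTop.1 (eventually_lt_of_lt_liminf hlt)
      simp only [Set.mem_iUnion, Set.mem_iInter, Set.mem_ofPred_eq]
      refine ⟨N, fun j hj => ?_⟩
      rw [hc, ← tsub_tsub, tsub_le_iff_right]
      calc 1 - δ ≤ ∫⁻ x, ρ j x ∂μ.toMeasure := (hN j hj).le
        _ ≤ ∫⁻ x, ENNReal.ofReal (φ j x) + γ x ∂μ.toMeasure :=
            lintegral_mono fun x => (hle j x).trans (add_le_add_right (ENNReal.le_tsum j) _)
        _ = ∫⁻ x, ENNReal.ofReal (φ j x) ∂μ.toMeasure + ∫⁻ x, γ x ∂μ.toMeasure :=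
            lintegral_add_left (hφm j) _
        _ ≤ _ := add_le_add_right (not_lt.1 hμγ) _
  · refine IsFSigma.union (IsFSigma.iUnion fun N => IsClosed.isFSigma ?_)
      (MPlus.isFSigma_lt_lintegral hγ δ)
    exact isClosed_biInter fun j _ =>
      isClosed_le continuous_const (MPlus.continuous_lintegral_compactlySupported (h0 j))
  · have hint : ∀ (ν : Measure X) j, ∫⁻ x, c⁻¹ * ENNReal.ofReal (φ j x) + δ⁻¹ * γ x ∂ν =
        c⁻¹ * ∫⁻ x, ENNReal.ofReal (φ j x) ∂ν + δ⁻¹ * ∫⁻ x, γ x ∂ν := fun ν j => by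
      rw [lintegral_add_left ((hφm j).const_mul _), lintegral_const_mul _ (hφm j),
        lintegral_const_mul _ hγ.measurable]
    refine iInf₂_le_of_le (fun j x => c⁻¹ * ENNReal.ofReal (φ j x) + δ⁻¹ * γ x) ⟨fun j => ?_, ?_⟩ ?_
    · refine LowerSemicontinuous.add (Continuous.lowerSemicontinuous ?_) ?_
      · exact (ENNReal.continuous_const_mul (ENNReal.inv_ne_top.2 hc0)).comp
          (ENNReal.continuous_ofReal.comp (φ j).continuous)
      · exact (ENNReal.continuous_const_mul (ENNReal.inv_ne_top.2 hδ)).comp_lowerSemicontinuous hγ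
          fun _ _ h => mul_le_mul_right h _
    · rintro μ (hμ | hμ)
      · simp only [Set.mem_iUnion, Set.mem_iInter, Set.mem_ofPred_eq] at hμ
        obtain ⟨N, hN⟩ := hμ
        refine le_liminf_of_le (by isBoundedDefault) (eventually_atTop.2 ⟨N, fun j hj => ?_⟩)
        rw [hint, ← ENNReal.inv_mul_cancel hc0 hct]
        exact (mul_le_mul_right (hN j hj) _).trans le_self_add
      · refine le_liminf_of_le (by isBoundedDefault) (Eventually.of_forall fun j => ?_)
        rw [hint, ← ENNReal.inv_mul_cancel hδ hδt]
        exact (mul_le_mul_right (le_of_lt hμ) _).trans le_add_self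
    · calc liminf (fun j => ∫⁻ x, c⁻¹ * ENNReal.ofReal (φ j x) + δ⁻¹ * γ x ∂m) atTop
          ≤ liminf (fun _ : ℕ => c⁻¹ * (a + δ * δ) + δ⁻¹ * (δ * δ)) atTop := by
            refine liminf_le_liminf (Eventually.of_forall fun j => ?_)
            simp only [hint]
            gcongr
            exact (hφint j).trans (add_le_add (hρa j) ((ENNReal.le_tsum j).trans hεsum.le))
        _ = c⁻¹ * (a + δ * δ) + δ := by
            rw [liminf_const, ← mul_assoc, ENNReal.inv_mul_cancel hδ hδt, one_mul]

/-- The content is approximated from outside by `F_σ` families at least as well as by admissible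
sequences. -/
theorem iInf_Ct_isFSigma_le_AM (m : Measure X) [m.Regular] (E : Set (MPlus X)) :
    ⨅ (G : Set (MPlus X)) (_ : E ⊆ G) (_ : IsFSigma G), Ct m G ≤ AM m E := by
  refine le_iInf₂ fun ρ hρ => le_of_forall_gt_imp_ge_of_dense fun a ha => ?_
  rcases eq_or_ne a ∞ with rfl | hat
  · exact le_top
  obtain ⟨θ, hθ, hθa⟩ := extraction_of_frequently_atTop (frequently_lt_of_liminf_lt
    (by isBoundedDefault) ha)
  have hρθ : IsAdmissibleSeq (fun j => ρ (θ j)) E :=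
    ⟨fun j => hρ.lsc _, fun μ hμ => (hρ.one_le μ hμ).trans
      (hθ.tendsto_atTop.liminf_le_liminf_comp (u := fun j => ∫⁻ x, ρ j x ∂μ.toMeasure))⟩
  have hlim : Tendsto (fun δ : ℝ≥0∞ => (1 - (δ + δ))⁻¹ * (a + δ * δ) + δ) (𝓝[>] 0) (𝓝 a) := by
    have h1 : Tendsto (fun δ : ℝ≥0∞ => δ) (𝓝[>] 0) (𝓝 0) := nhdsWithin_le_nhds
    have h2 : Tendsto (fun δ : ℝ≥0∞ => (1 - (δ + δ))⁻¹) (𝓝[>] 0) (𝓝 1) := by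
      have := (ENNReal.Tendsto.sub (tendsto_const_nhds (x := (1 : ℝ≥0∞))) (h1.add h1)
        (Or.inl ENNReal.one_ne_top))
      simpa using this.inv
    have h3 : Tendsto (fun δ : ℝ≥0∞ => a + δ * δ) (𝓝[>] 0) (𝓝 a) := by
      have := tendsto_const_nhds (x := a) |>.add
        (ENNReal.Tendsto.mul h1 (Or.inr ENNReal.zero_ne_top) h1 (Or.inr ENNReal.zero_ne_top))
      simpa using this
    simpa using (ENNReal.Tendsto.mul h2 (Or.inl one_ne_zero) h3
      (Or.inr ENNReal.one_ne_top)).add h1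
  refine ge_of_tendsto hlim ?_
  have hsmall : ∀ᶠ δ : ℝ≥0∞ in 𝓝[>] 0, δ + δ < 1 :=
    nhdsWithin_le_nhds ((continuous_id.add continuous_id).tendsto' (0 : ℝ≥0∞) 0 (by simp)
      |>.eventually_lt_const zero_lt_one)
  filter_upwards [hsmall, self_mem_nhdsWithin] with δ hδ1 hδ0
  obtain ⟨G, hEG, hG, hGa⟩ :=
    exists_isFSigma_AM_le m hρθ hat (fun j => (hθa j).le) (ne_of_gt hδ0) hδ1
  exact (iInf_le_of_le G (iInf₂_le hEG hG)).trans ((Ct_le_AM m G).trans hGa)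

end OuterRegularity

/-! ### Weak* compactness -/

section WeakStarCompactness

/-- Truncating the values of `f` in `[-ε, ε]` to zero makes the support compact. -/
theorem ZeroAtInftyContinuousMap.exists_compactlySupported_norm_sub_le {X : Type*}
    [TopologicalSpace X] [R1Space X] (f : C₀(X, ℝ)) {ε : ℝ} (hε : 0 < ε) :
    ∃ φ : C_c(X, ℝ), ‖f - (φ : C₀(X, ℝ))‖ ≤ ε := by
  have hev : ∀ᶠ x in cocompact X, |f x| < ε := by
    have := f.zero_at_infty'.eventually (Metric.ball_mem_nhds (0 : ℝ) hε)
    filter_upwards [this] with x hx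
    simpa using hx
  obtain ⟨K, hK, hKf⟩ := mem_cocompact.1 hev
  let φ : C_c(X, ℝ) :=
    ⟨⟨fun x => f x - max (-ε) (min ε (f x)), by fun_prop⟩, by
      refine HasCompactSupport.intro hK fun x hx => ?_
      have := abs_lt.1 (show |f x| < ε from hKf hx)
      simp [min_eq_right this.2.le, max_eq_right this.1.le]⟩
  refine ⟨φ, ?_⟩
  rw [← ZeroAtInftyContinuousMap.norm_toBCF_eq_norm, BoundedContinuousFunction.norm_le hε.le]
  intro x
  change |f x - (f x - max (-ε) (min ε (f x)))| ≤ ε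
  rw [sub_sub_cancel, abs_le]
  exact ⟨le_max_left _ _, max_le (by linarith) (min_le_left _ _)⟩

/-- The positive linear functionals on `C₀(X)` of norm at most `r`, encoded as a subset of the
product space `C₀(X) → ℝ`, whose topology induces the weak* topology. -/
def positiveFunctionals (X : Type*) [TopologicalSpace X] (r : ℝ) : Set (C₀(X, ℝ) → ℝ) :=
  {L | (∀ f, |L f| ≤ r * ‖f‖) ∧ (∀ f g, L (f + g) = L f + L g) ∧
    (∀ (c : ℝ) f, L (c • f) = c * L f) ∧ ∀ f, (∀ x, 0 ≤ f x) → 0 ≤ L f}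

/-- The Banach-Alaoglu theorem for positive functionals, by Tychonoff's theorem. -/
theorem isCompact_positiveFunctionals (X : Type*) [TopologicalSpace X] (r : ℝ) :
    IsCompact (positiveFunctionals X r) := by
  refine IsCompact.of_isClosed_subset
    (isCompact_univ_pi fun f : C₀(X, ℝ) => isCompact_Icc (a := -(r * ‖f‖)) (b := r * ‖f‖)) ?_
    fun L hL f _ => abs_le.1 (hL.1 f)
  simp only [positiveFunctionals, Set.ofPred_and, Set.ofPred_forall]
  refine (isClosed_iInter fun f => isClosed_le (by fun_prop) (by fun_prop)).inter
    ((isClosed_iInter fun f => isClosed_iInter fun g =>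
      isClosed_eq (by fun_prop) (by fun_prop)).inter
    ((isClosed_iInter fun c => isClosed_iInter fun f =>
      isClosed_eq (by fun_prop) (by fun_prop)).inter
    (isClosed_iInter fun f => isClosed_iInter fun _ => isClosed_le (by fun_prop) (by fun_prop))))

/-- A bounded functional on `C₀(X)` is determined by its values on `C_c(X)`. -/
theorem positiveFunctionals_ext {X : Type*} [TopologicalSpace X] [R1Space X] {r : ℝ}
    {L L' : C₀(X, ℝ) → ℝ} (hL : L ∈ positiveFunctionals X r) (hL' : L' ∈ positiveFunctionals X r)
    (h : ∀ φ : C_c(X, ℝ), L φ = L' φ) : L = L' := by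
  funext f
  refine sub_eq_zero.1 (abs_nonpos_iff.1 (le_of_forall_pos_le_add fun ε hε => ?_))
  have hr : 0 < 2 * |r| + 1 := by positivity
  obtain ⟨φ, hφ⟩ := f.exists_compactlySupported_norm_sub_le (div_pos hε hr)
  have hbound : ∀ M ∈ positiveFunctionals X r, |M f - M φ| ≤ |r| * (ε / (2 * |r| + 1)) := by
    intro M hM
    have hM' : M f = M (f - (φ : C₀(X, ℝ))) + M φ := by rw [← hM.2.1, sub_add_cancel]
    rw [hM', add_sub_cancel_right]
    exact (hM.1 _).trans (mul_le_mul (le_abs_self r) hφ (norm_nonneg _) (abs_nonneg r))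
  have hε' : 2 * (|r| * (ε / (2 * |r| + 1))) ≤ ε := by
    rw [← mul_assoc, mul_div_assoc', div_le_iff₀ hr]
    nlinarith
  have h1 := abs_le.1 (hbound L hL)
  have h2 := abs_le.1 (hbound L' hL')
  rw [h φ] at h1
  exact abs_le.2 ⟨by linarith, by linarith⟩

variable {X : Type*} [TopologicalSpace X] [MeasurableSpace X]

theorem MPlus.integral_mem_positiveFunctionals [OpensMeasurableSpace X] {r : ℝ} {μ : MPlus X}
    (hμ : μ.toMeasure.real Set.univ ≤ r) :
    (fun f : C₀(X, ℝ) => ∫ x, f x ∂μ.toMeasure) ∈ positiveFunctionals X r := by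
  have hint : ∀ f : C₀(X, ℝ), Integrable (fun x => f x) μ.toMeasure :=
    fun f => f.toBCF.integrable μ.toMeasure
  refine ⟨fun f => ?_, fun f g => integral_add (hint f) (hint g),
    fun c f => integral_const_mul c _, fun f hf => integral_nonneg hf⟩
  have h : ‖∫ x, f x ∂μ.toMeasure‖ ≤ ‖f‖ * μ.toMeasure.real Set.univ :=
    norm_integral_le_of_norm_le_const (Eventually.of_forall fun x => f.toBCF.norm_coe_le_norm x)
  rw [mul_comm]
  exact h.trans (mul_le_mul_of_nonneg_left hμ (norm_nonneg _))

variable [LocallyCompactSpace X] [BorelSpace X]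

/-- The Riesz representation theorem for positive functionals on `C₀(X)`: the measure comes from
the restriction to `C_c(X)`, and its mass from inner regularity. -/
theorem exists_MPlus_of_mem_positiveFunctionals [T2Space X] {r : ℝ} (hr : 0 ≤ r)
    {L : C₀(X, ℝ) → ℝ} (hL : L ∈ positiveFunctionals X r) :
    ∃ μ : MPlus X, μ.toMeasure.real Set.univ ≤ r ∧
      (fun f : C₀(X, ℝ) => ∫ x, f x ∂μ.toMeasure) = L := by
  let Λ : C_c(X, ℝ) →ₚ[ℝ] ℝ := PositiveLinearMap.mk₀
    { toFun := fun φ => L φ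
      map_add' := fun φ ψ => hL.2.1 φ ψ
      map_smul' := fun c φ => hL.2.2.1 c φ }
    fun φ hφ => hL.2.2.2 φ hφ
  have hmass : RealRMK.rieszMeasure Λ Set.univ ≤ ENNReal.ofReal r := by
    rw [isOpen_univ.measure_eq_iSup_isCompact]
    refine iSup₂_le fun K _ => iSup_le fun hK => ?_
    obtain ⟨f, hf1, -, hfc, hf01⟩ := exists_continuous_one_zero_of_isCompact hK isClosed_empty
      (Set.disjoint_empty K)
    let φ : C_c(X, ℝ) := ⟨f, hfc⟩
    refine (RealRMK.rieszMeasure_le_of_eq_one Λ (f := φ) (fun x => (hf01 x).1) hK hf1).trans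
      (ENNReal.ofReal_le_ofReal ((le_abs_self _).trans ((hL.1 φ).trans ?_)))
    refine mul_le_of_le_one_right hr ?_
    rw [← ZeroAtInftyContinuousMap.norm_toBCF_eq_norm,
      BoundedContinuousFunction.norm_le zero_le_one]
    exact fun x => abs_le.2 ⟨(neg_nonpos.2 zero_le_one).trans (hf01 x).1, (hf01 x).2⟩
  let μ : MPlus X := ⟨RealRMK.rieszMeasure Λ, ⟨hmass.trans_lt ENNReal.ofReal_lt_top⟩⟩
  have hμ : μ.toMeasure.real Set.univ ≤ r := ENNReal.toReal_le_of_le_ofReal hr hmass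
  exact ⟨μ, hμ, positiveFunctionals_ext (MPlus.integral_mem_positiveFunctionals hμ) hL
    (RealRMK.integral_rieszMeasure Λ)⟩

/-- The closed balls of `M⁺(X)` are weak* compact. The total mass may drop in a weak* limit, but it
does not grow. -/
theorem MPlus.isCompact_setOf_real_univ_le [T2Space X] {r : ℝ} (hr : 0 ≤ r) :
    IsCompact {μ : MPlus X | μ.toMeasure.real Set.univ ≤ r} := by
  refine (Topology.IsInducing.isCompact_iff ⟨rfl⟩).2 ?_
  convert isCompact_positiveFunctionals X r
  ext L
  constructor
  · rintro ⟨μ, hμ, rfl⟩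
    exact MPlus.integral_mem_positiveFunctionals hμ
  · intro hL
    obtain ⟨μ, hμ, hμL⟩ := exists_MPlus_of_mem_positiveFunctionals hr hL
    exact ⟨μ, hμ, hμL⟩

instance MPlus.instT2Space [PolishSpace X] : T2Space (MPlus X) := by
  let _ := TopologicalSpace.upgradeIsCompletelyMetrizable X
  refine T2Space.of_injective_continuous
    (f := fun (μ : MPlus X) (f : C₀(X, ℝ)) => ∫ x, f x ∂μ.toMeasure) (fun μ ν h => ?_)
    continuous_induced_dom
  exact Subtype.ext (Measure.ext_of_integral_eq_on_compactlySupported (μ := μ.toMeasure)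
    (ν := ν.toMeasure) fun φ => congrFun h φ)

end WeakStarCompactness

/-! ### Strong duality -/

section CompactDuality

/-- A form of the Hahn-Banach theorem. The cone `C` consists of pairs `(u, c)`, read as "`u` can be
had at the price `c`"; `L` is a system of prices below all these offers, under which `e` costs at
least the infimum of the prices of all `u ≥ e` on offer. -/
theorem PointedCone.exists_nonneg_linearMap_le {F : Type*} [AddCommGroup F] [PartialOrder F]
    [IsOrderedAddMonoid F] [Module ℝ F] [PosSMulMono ℝ F] (C : PointedCone ℝ (F × ℝ))
    (hC : ∀ p ∈ C, 0 ≤ p.2) (hdom : ∀ h : F, ∃ p ∈ C, h ≤ p.1) (e : F) :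
    ∃ L : F →ₗ[ℝ] ℝ, (∀ h, 0 ≤ h → 0 ≤ L h) ∧ (∀ p ∈ C, L p.1 ≤ p.2) ∧
      ∀ t, (∀ p ∈ C, e ≤ p.1 → t ≤ p.2) → t ≤ L e := by
  rcases eq_or_ne e 0 with rfl | he
  · exact ⟨0, fun _ _ => le_rfl, hC, fun t ht => by simpa using ht 0 C.zero_mem le_rfl⟩
  let A : F → Set ℝ := fun h => {c | ∃ p ∈ C, h ≤ p.1 ∧ p.2 = c}
  have hA : ∀ h, (A h).Nonempty := fun h =>
    let ⟨p, hp, hhp⟩ := hdom h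
    ⟨p.2, p, hp, hhp, rfl⟩
  have hA0 : ∀ h, ∀ c ∈ A h, 0 ≤ c := by
    rintro h _ ⟨p, hp, -, rfl⟩
    exact hC p hp
  let N : F → ℝ := fun h => sInf (A h)
  have hN0 : ∀ h, 0 ≤ N h := fun h => Real.sInf_nonneg (hA0 h)
  have hNle : ∀ {h} {p : F × ℝ}, p ∈ C → h ≤ p.1 → N h ≤ p.2 := fun hp hhp =>
    csInf_le ⟨0, hA0 _⟩ ⟨_, hp, hhp, rfl⟩
  have hNsmul : ∀ c : ℝ, 0 < c → ∀ h, N (c • h) ≤ c * N h := by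
    intro c hc h
    rw [← div_le_iff₀' hc]
    refine le_csInf (hA h) ?_
    rintro _ ⟨p, hp, hhp, rfl⟩
    rw [div_le_iff₀' hc]
    exact hNle (p := c • p) (C.smul_mem hc.le hp) (smul_le_smul_of_nonneg_left hhp hc.le)
  have hNhom : ∀ c : ℝ, 0 < c → ∀ h, N (c • h) = c * N h := by
    refine fun c hc h => le_antisymm (hNsmul c hc h) ?_
    have := hNsmul c⁻¹ (inv_pos.2 hc) (c • h)
    rwa [inv_smul_smul₀ hc.ne', ← div_eq_inv_mul, le_div_iff₀' hc] at this
  have hNadd : ∀ x y, N (x + y) ≤ N x + N y := by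
    intro x y
    rw [← sub_le_iff_le_add]
    refine le_csInf (hA x) ?_
    rintro _ ⟨p, hp, hxp, rfl⟩
    rw [sub_le_comm]
    refine le_csInf (hA y) ?_
    rintro _ ⟨q, hq, hyq, rfl⟩
    rw [sub_le_iff_le_add']
    exact hNle (p := p + q) (C.add_mem hp hq) (add_le_add hxp hyq)
  obtain ⟨L, hLe, hLN⟩ := exists_extension_of_le_sublinear
    (LinearPMap.mkSpanSingleton (σ := RingHom.id ℝ) e (N e) he) N hNhom hNadd (by
      rintro ⟨x, hx⟩
      obtain ⟨a, rfl⟩ := Submodule.mem_span_singleton.1 hx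
      rw [LinearPMap.mkSpanSingleton'_apply]
      rcases lt_or_ge 0 a with ha | ha
      · exact (hNhom a ha e).ge
      · exact (mul_nonpos_of_nonpos_of_nonneg ha (hN0 e)).trans (hN0 _))
  refine ⟨L, fun h hh => ?_, fun p hp => (hLN _).trans (hNle hp le_rfl), fun t ht => ?_⟩
  · have : L (-h) ≤ 0 := (hLN _).trans (hNle (p := 0) C.zero_mem (neg_nonpos.2 hh))
    simpa using this
  · have : L e = N e := by
      exact (hLe ⟨e, Submodule.mem_span_singleton_self e⟩).trans
        (LinearPMap.mkSpanSingleton_apply ℝ ℝ he (N e))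
    rw [this]
    refine le_csInf (hA e) ?_
    rintro _ ⟨p, hp, hep, rfl⟩
    exact ht p hp hep

variable {X : Type*} [TopologicalSpace X] [MeasurableSpace X]

/-- The function `μ ↦ ∫ φ dμ` restricted to a set of measures. -/
noncomputable def MPlus.integralOn (K : Set (MPlus X)) (φ : C_c(X, ℝ)) : C(K, ℝ) :=
  ⟨fun κ => ∫ x, φ x ∂κ.1.toMeasure,
    (MPlus.continuous_integral (φ : C₀(X, ℝ))).comp continuous_subtype_val⟩

theorem MPlus.integralOn_apply (K : Set (MPlus X)) (φ : C_c(X, ℝ)) (κ : K) :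
    MPlus.integralOn K φ κ = ∫ x, φ x ∂κ.1.toMeasure := rfl

theorem integral_compactlySupported_add [OpensMeasurableSpace X] (μ : Measure X)
    [IsFiniteMeasureOnCompacts μ] (φ ψ : C_c(X, ℝ)) :
    ∫ x, (φ + ψ) x ∂μ = ∫ x, φ x ∂μ + ∫ x, ψ x ∂μ :=
  integral_add (φ.continuous.integrable_of_hasCompactSupport φ.hasCompactSupport)
    (ψ.continuous.integrable_of_hasCompactSupport ψ.hasCompactSupport)

theorem integral_compactlySupported_smul (μ : Measure X) (c : ℝ) (φ : C_c(X, ℝ)) :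
    ∫ x, (c • φ) x ∂μ = c * ∫ x, φ x ∂μ :=
  integral_const_mul c _

/-- The offers in the linear programme dual to the content of `K`: the function
`μ ↦ ∫ φ dμ + s` on `K` costs `∫ φ dm + M s`. The slack `s` has the penalty price `M`; it makes
every continuous function on `K` affordable, even if `K` contains the zero measure. -/
noncomputable def penaltyCone [OpensMeasurableSpace X] (m : Measure X) [IsFiniteMeasureOnCompacts m]
    (K : Set (MPlus X)) (M : ℝ) : PointedCone ℝ (C(K, ℝ) × ℝ) where
  carrier := {p | ∃ φ : C_c(X, ℝ), 0 ≤ φ ∧ ∃ s : ℝ, 0 ≤ s ∧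
    (∀ κ, p.1 κ = MPlus.integralOn K φ κ + s) ∧ p.2 = ∫ x, φ x ∂m + M * s}
  zero_mem' := ⟨0, le_rfl, 0, le_rfl, by simp [MPlus.integralOn_apply], by simp⟩
  add_mem' := by
    rintro p q ⟨φ, hφ, s, hs, h1, h2⟩ ⟨ψ, hψ, t, ht, h3, h4⟩
    refine ⟨φ + ψ, add_nonneg hφ hψ, s + t, add_nonneg hs ht, fun κ => ?_, ?_⟩
    · rw [MPlus.integralOn_apply, integral_compactlySupported_add, Prod.fst_add,
        ContinuousMap.add_apply, h1, h3, MPlus.integralOn_apply, MPlus.integralOn_apply]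
      ring
    · rw [integral_compactlySupported_add, Prod.snd_add, h2, h4]
      ring
  smul_mem' := by
    rintro ⟨c, hc⟩ p ⟨φ, hφ, s, hs, h1, h2⟩
    refine ⟨c • φ, fun x => mul_nonneg hc (hφ x), c * s, mul_nonneg hc hs, fun κ => ?_, ?_⟩
    · rw [MPlus.integralOn_apply, integral_compactlySupported_smul]
      change c * p.1 κ = _
      rw [h1, MPlus.integralOn_apply]
      ring
    · rw [integral_compactlySupported_smul]
      change c * p.2 = _
      rw [h2]
      ring

variable [PolishSpace X] [LocallyCompactSpace X] [BorelSpace X]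

/-- A positive functional on `C(K)` below the prices `∫ φ dm` of the functions `μ ↦ ∫ φ dμ` is
represented by a plan carried by `K`. -/
theorem ofReal_le_Ct_of_linearMap (m : Measure X) [m.Regular] {K : Set (MPlus X)}
    (hK : IsCompact K) (L : C(K, ℝ) →ₗ[ℝ] ℝ) (hL : ∀ h, 0 ≤ h → 0 ≤ L h)
    (hLm : ∀ φ : C_c(X, ℝ), 0 ≤ φ → L (MPlus.integralOn K φ) ≤ ∫ x, φ x ∂m) :
    ENNReal.ofReal (L 1) ≤ Ct m K := by
  have : CompactSpace K := isCompact_iff_compactSpace.1 hK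
  let Λ : C_c(K, ℝ) →ₚ[ℝ] ℝ := PositiveLinearMap.mk₀
    { toFun := fun φ => L φ.toContinuousMap
      map_add' := fun φ ψ => L.map_add φ.toContinuousMap ψ.toContinuousMap
      map_smul' := fun c φ => L.map_smul c φ.toContinuousMap }
    fun φ hφ => hL φ.toContinuousMap hφ
  let ηK : Measure K := RealRMK.rieszMeasure Λ
  have hηK : ∀ h : C(K, ℝ), ∫ κ, h κ ∂ηK = L h := fun h =>
    RealRMK.integral_rieszMeasure Λ ⟨h, HasCompactSupport.of_compactSpace _⟩
  have hlint : ∀ h : C(K, ℝ), 0 ≤ h → ∫⁻ κ, ENNReal.ofReal (h κ) ∂ηK = ENNReal.ofReal (L h) := by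
    intro h hh
    rw [← hηK, ofReal_integral_eq_lintegral_ofReal
      (h.continuous.integrable_of_hasCompactSupport (HasCompactSupport.of_compactSpace _))
      (Eventually.of_forall fun κ => hh κ)]
  let η : Measure (MPlus X) := ηK.map Subtype.val
  have hle : barycenter η ≤ m := by
    refine measure_le_of_lintegral_compactlySupported_le fun φ hφ => ?_
    have hm : Measurable fun x => ENNReal.ofReal (φ x) := φ.continuous.measurable.ennreal_ofReal
    rw [lintegral_barycenter η hm,
      lintegral_map (MPlus.measurable_lintegral hm) measurable_subtype_coe]
    simp_rw [fun κ : K => φ.lintegral_ofReal κ.1.toMeasure hφ]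
    refine (hlint (MPlus.integralOn K φ) fun κ => integral_nonneg hφ).trans_le ?_
    rw [φ.lintegral_ofReal m hφ]
    exact ENNReal.ofReal_le_ofReal (hLm φ hφ)
  have : SigmaFinite (barycenter η) := Measure.sigmaFinite_of_le m hle
  have hηKuniv : η K = ENNReal.ofReal (L 1) := by
    rw [Measure.map_apply measurable_subtype_coe hK.isClosed.measurableSet,
      Subtype.coe_preimage_self, ← hlint 1 zero_le_one]
    simp
  rw [← hηKuniv]
  exact le_iSup₂_of_le η (IsContentPlan.of_barycenter_le hle) le_rfl

/-- Strong duality for compact families: every number above the content bounds the cost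
`∫ φ dm` of a compactly supported continuous `φ ≥ 0` with `∫ φ dμ ≥ 1` on the family. -/
theorem exists_compactlySupported_of_Ct_lt (m : Measure X) [m.Regular] {K : Set (MPlus X)}
    (hK : IsCompact K) {b : ℝ≥0∞} (hb : Ct m K < b) :
    ∃ φ : C_c(X, ℝ), 0 ≤ φ ∧ (∀ μ ∈ K, 1 ≤ ∫⁻ x, ENNReal.ofReal (φ x) ∂μ.toMeasure) ∧
      ∫⁻ x, ENNReal.ofReal (φ x) ∂m ≤ b := by
  have : CompactSpace K := isCompact_iff_compactSpace.1 hK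
  obtain ⟨c, hKc, hcb⟩ := ENNReal.lt_iff_exists_nnreal_btwn.1 hb
  obtain ⟨a, hKa, hac⟩ := ENNReal.lt_iff_exists_nnreal_btwn.1 hKc
  have hac' : (a : ℝ) < c := by exact_mod_cast hac
  have ha0 : (0 : ℝ) < a := by
    exact_mod_cast (zero_le (a := Ct m K)).trans_lt hKa
  have hc0 : (0 : ℝ) < c := ha0.trans hac'
  -- With this penalty, a slack that costs at most `a` is at most `1 - a / c`.
  let M : ℝ := a * c / (c - a)
  have hM : 0 < M := div_pos (mul_pos ha0 hc0) (sub_pos.2 hac')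
  obtain ⟨L, hL0, hLC, hL1⟩ := (penaltyCone m K M).exists_nonneg_linearMap_le
    (by
      rintro p ⟨φ, hφ, s, hs, -, h⟩
      rw [h]
      exact add_nonneg (integral_nonneg hφ) (mul_nonneg hM.le hs))
    (fun h => ⟨(ContinuousMap.const K ‖h‖, M * ‖h‖), ⟨0, le_rfl, ‖h‖, norm_nonneg h,
      by simp [MPlus.integralOn_apply], by simp⟩, fun κ => h.apply_le_norm κ⟩) 1
  have hLa : L 1 < a := by
    have := (ofReal_le_Ct_of_linearMap m hK L hL0 fun φ hφ =>
      hLC (MPlus.integralOn K φ, ∫ x, φ x ∂m) ⟨φ, hφ, 0, le_rfl, by simp, by simp⟩).trans_lt hKa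
    rw [← ENNReal.ofReal_coe_nnreal] at this
    exact (ENNReal.ofReal_lt_ofReal_iff ha0).1 this
  obtain ⟨p, ⟨φ, hφ, s, hs, hp1, hp2⟩, h1p, hpa⟩ : ∃ p ∈ penaltyCone m K M, 1 ≤ p.1 ∧ p.2 < a := by
    by_contra! h
    exact hLa.not_ge (hL1 a h)
  rw [hp2] at hpa
  have hI : 0 ≤ ∫ x, φ x ∂m := integral_nonneg hφ
  have hs1 : a / c ≤ 1 - s := by
    have h1 : M * s ≤ a := by linarith
    have h2 : c * s ≤ c - a := by
      rw [div_mul_eq_mul_div, div_le_iff₀ (sub_pos.2 hac')] at h1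
      nlinarith
    rw [div_le_iff₀ hc0]
    linarith
  have hs1' : 0 < 1 - s := (div_pos ha0 hc0).trans_le hs1
  have hψ : 0 ≤ (1 - s)⁻¹ • φ := fun x => mul_nonneg (inv_pos.2 hs1').le (hφ x)
  refine ⟨(1 - s)⁻¹ • φ, hψ, fun μ hμ => ?_, ?_⟩
  · rw [CompactlySupportedContinuousMap.lintegral_ofReal _ hψ, integral_compactlySupported_smul,
      ← ENNReal.ofReal_one]
    refine ENNReal.ofReal_le_ofReal ?_
    rw [← div_eq_inv_mul, le_div_iff₀ hs1', one_mul]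
    have h1 : 1 ≤ p.1 ⟨μ, hμ⟩ := h1p ⟨μ, hμ⟩
    rw [hp1, MPlus.integralOn_apply] at h1
    linarith
  · refine le_trans ?_ hcb.le
    rw [CompactlySupportedContinuousMap.lintegral_ofReal _ hψ, integral_compactlySupported_smul,
      ← ENNReal.ofReal_coe_nnreal]
    refine ENNReal.ofReal_le_ofReal ?_
    rw [← div_eq_inv_mul, div_le_iff₀ hs1']
    rw [div_le_iff₀ hc0] at hs1
    nlinarith [mul_nonneg hM.le hs]

/-- An `F_σ` family is an increasing union of compact ones; near-optimal functions for these form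
an admissible sequence. -/
theorem IsFSigma.AM_le_Ct (m : Measure X) [m.Regular] {G : Set (MPlus X)} (hG : IsFSigma G) :
    AM m G ≤ Ct m G := by
  obtain ⟨F, hF, hGF⟩ := hG
  let K : ℕ → Set (MPlus X) := fun n =>
    (⋃ k ∈ Finset.range (n + 1), F k) ∩ {μ | μ.toMeasure.real Set.univ ≤ n}
  have hK : ∀ n, IsCompact (K n) := fun n =>
    (MPlus.isCompact_setOf_real_univ_le n.cast_nonneg).inter_left
      (isClosed_biUnion_finset fun k _ => hF k)
  have hKG : ∀ n, K n ⊆ G := fun n μ hμ => by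
    rw [hGF]
    exact Set.iUnion₂_subset (fun k _ => Set.subset_iUnion F k) hμ.1
  refine le_of_forall_gt_imp_ge_of_dense fun b hb => ?_
  choose φ h0 h1 hφ using fun n =>
    exists_compactlySupported_of_Ct_lt m (hK n) ((Ct_mono m (hKG n)).trans_lt hb)
  refine iInf₂_le_of_le (fun n x => ENNReal.ofReal (φ n x)) ⟨fun n => ?_, fun μ hμ => ?_⟩ ?_
  · exact (ENNReal.continuous_ofReal.comp (φ n).continuous).lowerSemicontinuous
  · rw [hGF] at hμ
    obtain ⟨k, hk⟩ := Set.mem_iUnion.1 hμ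
    obtain ⟨r, hr⟩ := exists_nat_ge (μ.toMeasure.real Set.univ)
    refine le_liminf_of_le (by isBoundedDefault)
      (eventually_atTop.2 ⟨max k r, fun n hn => h1 n μ ⟨?_, ?_⟩⟩)
    · refine Set.mem_iUnion₂.2 ⟨k, ?_, hk⟩
      have := (le_max_left k r).trans hn
      simpa using Nat.lt_succ_of_le this
    · exact hr.trans (Nat.cast_le.2 ((le_max_right k r).trans hn))
  · exact (liminf_le_liminf (Eventually.of_forall hφ)).trans_eq (liminf_const b)

end CompactDuality

theorem theoremt {X : Type*} [TopologicalSpace X] [PolishSpace X] [LocallyCompactSpace X]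
    [MeasurableSpace X] [BorelSpace X]
    (m : Measure X) [IsFiniteMeasureOnCompacts m] [m.InnerRegular]
    (E : Set (MPlus X)) :
    Ct m E ≤ AM m E ∧
      AM m E = ⨅ (G : Set (MPlus X)) (_ : E ⊆ G) (_ : IsFSigma G), Ct m G := by
  let _ := TopologicalSpace.upgradeIsCompletelyMetrizable X
  -- `m` is locally finite on a σ-compact metrizable space.
  have : m.Regular := inferInstance
  refine ⟨Ct_le_AM m E, le_antisymm ?_ (iInf_Ct_isFSigma_le_AM m E)⟩
  exact le_iInf₂ fun G hEG => le_iInf fun hG => (AM_mono m hEG).trans (hG.AM_le_Ct m)
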